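/- Let $\mathbb F_q$ be a finite field with $\operatorname{char}\mathbb F_q=p>3$ and $3\mid q-1$. A subalgebra $H$ of a Lie algebra $\mathfrak L$ over $\mathbb F_q$ with zero center and $[\mathfrak L,\mathfrak L]=\mathfrak L$ is called a classical Cartan subalgebra if it is an abelian Cartan subalgebra (nilpotent and self-normalizing) such that: (a) $\mathfrak L=\bigoplus_\alpha \mathfrak L_\alpha$, where $\alpha$ ranges over the linear functionals on $H$ and $\mathfrak L_\alpha=\{x: [x,h]=\alpha(h)x\ \text{for all } h\in H\}$ ($\alpha$ is a root if $\mathfrak L_\alpha\ne 0$); (b) $[\mathfrak L_\alpha,\mathfrak L_{-\alpha}]$ is one-dimensional for every root $\alpha\neq 0$; (c) for roots $\alpha,\beta$ with $\beta\neq0$, not all $\alpha+k\beta$, $1\le k\le p-1$, are roots. A classical orthogonal decomposition (COD) of $\mathfrak{sl}_3(\mathbb F_q)$ is a decomposition $\mathfrak{sl}_3(\mathbb F_q)=H_0\oplus H_1\oplus H_2\oplus H_3$ into classical Cartan subalgebras that are pairwise orthogonal with respect to the Killing form. Two such decompositions are conjugate if some automorphism of the Lie algebra $\mathfrak{sl}_3(\mathbb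 F_q)$ maps the components of the first bijectively onto the components of the second. For $a,b\in\mathbb F_q$ put $$C(a,b)=\left\langle\begin{pmatrix}0&1&0\\0&0&a\\ab&0&0\end{pmatrix},\begin{pmatrix}0&0&1\\ab&0&0\\0&b&0\end{pmatrix}\right\rangle_{\mathbb F_q},$$ let $H_0$ be the subalgebra of diagonal matrices in $\mathfrak{sl}_3(\mathbb F_q)$, and, for a primitive cube root of unity $u$, let $J_3(a,b)$ be the family of subalgebras $H_0,\ C(a,b),\ C(ua,ub),\ C(u^2a,u^2b)$. Then $\mathbb F_q$ contains a primitive cube root of unity, and for every primitive cube root of unity $u\in\mathbb F_q$: the family $J_3(1,1)$ is a COD of $\mathfrak{sl}_3(\mathbb F_q)$, and every COD of $\mathfrak{sl}_3(\mathbb F_q)$ is conjugate to $J_3(1,1)$. Moreover, if $z\in\mathbb F_q$ is not a cube in $\mathbb F_q$, then the component $C(1,z)$ of $J_3(1,z)$ is not diagonalizable (no invertible matrix over $\mathbb F_q$ simultaneously conjugates all its elements to diagonal matrices) and is not a classical Cartan subalgebra of $\mathfrak{sl}_3(\mathbb F_q)$. -/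

import Mathlib

namespace ClassicalOD

section General

variable {F L : Type*} [Field F] [LieRing L] [LieAlgebra F L]

/-- The root space `L_α = {x | [x, h] = α(h) x for all h ∈ H}`. -/
def rootSpace (H : LieSubalgebra F L) (α : Module.Dual F H) : Submodule F L where
  carrier := {x | ∀ h : H, ⁅x, (h : L)⁆ = α h • x}
  add_mem' := by
    intro x y hx hy h
    rw [add_lie, hx h, hy h, smul_add]
  zero_mem' := by
    intro h
    simp
  smul_mem' := by
    intro c x hx h
    rw [smul_lie, hx h, smul_comm]

/-- A root is a functional with nonzero root space; `0` is counted as a root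
when its root space is nonzero. -/
def IsRoot (H : LieSubalgebra F L) (α : Module.Dual F H) : Prop :=
  rootSpace H α ≠ ⊥

/-- The Lie algebra `L`, over a field of characteristic `p > 3`, is classical and `H` is a
classical Cartan subalgebra of it. -/
structure IsClassicalCartan (H : LieSubalgebra F L) : Prop where
  /-- The center of `L` is zero. -/
  center_eq_bot : LieAlgebra.center F L = ⊥
  /-- `[L, L] = L`. -/
  derived_eq_top : ⁅(⊤ : LieIdeal F L), (⊤ : LieIdeal F L)⁆ = ⊤
  /-- `H` is nilpotent and self-normalizing. -/
  cartan : H.IsCartanSubalgebra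
  abelian : IsLieAbelian H
  /-- `L` is the direct sum of the root spaces. -/
  independent : iSupIndep (fun α : Module.Dual F H => rootSpace H α)
  spanning : (⨆ α : Module.Dual F H, rootSpace H α) = ⊤
  /-- `[L_α, L_{-α}]` is one-dimensional for every nonzero root `α`. -/
  bracket_one_dim : ∀ α : Module.Dual F H, α ≠ 0 → IsRoot H α →
    Module.finrank F (Submodule.span F
      {z : L | ∃ x ∈ rootSpace H α, ∃ y ∈ rootSpace H (-α), z = ⁅x, y⁆}) = 1
  /-- Not all of `α + β, …, α + (p - 1) β` are roots, for roots `α`, `β` with `β ≠ 0`. -/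
  string : ∀ α β : Module.Dual F H, IsRoot H α → IsRoot H β → β ≠ 0 →
    ∃ k : ℕ, 1 ≤ k ∧ k < ringChar F ∧ ¬ IsRoot H (α + k • β)

/-- Two families of subalgebras are conjugate if an automorphism of `L` maps the components of
the first bijectively to those of the second. -/
def Conjugate {ι : Type*} (H H' : ι → LieSubalgebra F L) : Prop :=
  ∃ (φ : L ≃ₗ⁅F⁆ L) (σ : Equiv.Perm ι), ∀ i, (H i).map φ.toLieHom = H' (σ i)

end General

/-- The Lie algebra of traceless `n × n` matrices. -/
abbrev sl (n : ℕ) (F : Type*) [Field F] := LieAlgebra.SpecialLinear.sl (Fin n) F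

/-- A classical orthogonal decomposition `sl_n(F) = H_0 ⊕ H_1 ⊕ ⋯ ⊕ H_n` into classical Cartan
subalgebras that are pairwise orthogonal for the Killing form. -/
structure IsCOD {F : Type*} [Field F] {n : ℕ}
    (H : Fin (n + 1) → LieSubalgebra F (sl n F)) : Prop where
  classical : ∀ i, IsClassicalCartan (H i)
  orthogonal : ∀ i j, i ≠ j → ∀ x ∈ H i, ∀ y ∈ H j, killingForm F (sl n F) x y = 0
  independent : iSupIndep (fun i => (H i).toSubmodule)
  spanning : (⨆ i, (H i).toSubmodule) = ⊤

section JThree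

variable {F : Type*} [Field F]

/-- The subalgebra of diagonal matrices in `sl_3(F)`. -/
def diagSubalgebra (F : Type*) [Field F] : LieSubalgebra F (sl 3 F) where
  carrier := {x | (x : Matrix (Fin 3) (Fin 3) F).IsDiag}
  add_mem' := fun hx hy => Matrix.IsDiag.add hx hy
  zero_mem' := Matrix.isDiag_zero
  smul_mem' := fun c _ hx => Matrix.IsDiag.smul c hx
  lie_mem' := by
    intro x y hx hy
    have hx' : (x : Matrix (Fin 3) (Fin 3) F).IsDiag := hx
    have hy' : (y : Matrix (Fin 3) (Fin 3) F).IsDiag := hy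
    change (⁅x, y⁆ : sl 3 F).val.IsDiag
    rw [LieAlgebra.SpecialLinear.sl_bracket, ← hx'.diagonal_diag, ← hy'.diagonal_diag,
      Matrix.diagonal_mul_diagonal, Matrix.diagonal_mul_diagonal]
    exact (Matrix.isDiag_diagonal _).sub (Matrix.isDiag_diagonal _)

/-- The first basis matrix of a component. -/
def matX (a b : F) : sl 3 F :=
  ⟨!![0, 1, 0; 0, 0, a; a * b, 0, 0], by
    simp [LieAlgebra.SpecialLinear.sl, Matrix.trace, Fin.sum_univ_three]⟩

/-- The second basis matrix of a component. -/
def matY (a b : F) : sl 3 F :=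
  ⟨!![0, 0, 1; a * b, 0, 0; 0, b, 0], by
    simp [LieAlgebra.SpecialLinear.sl, Matrix.trace, Fin.sum_univ_three]⟩

lemma lie_matX_matY (a b : F) : ⁅matX a b, matY a b⁆ = 0 := by
  apply Subtype.ext
  rw [LieAlgebra.SpecialLinear.sl_bracket]
  ext i j
  fin_cases i <;> fin_cases j <;>
    simp [matX, matY, mul_comm]

/-- The component `⟨X(a,b), Y(a,b)⟩` (linear span). -/
def comp (a b : F) : LieSubalgebra F (sl 3 F) where
  toSubmodule := Submodule.span F {matX a b, matY a b}
  lie_mem' := by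
    intro x y hx hy
    obtain ⟨s, t, rfl⟩ := Submodule.mem_span_pair.mp hx
    obtain ⟨s', t', rfl⟩ := Submodule.mem_span_pair.mp hy
    have h : ⁅matY a b, matX a b⁆ = 0 := by rw [← lie_skew, lie_matX_matY, neg_zero]
    have h0 : ⁅s • matX a b + t • matY a b, s' • matX a b + t' • matY a b⁆ = 0 := by
      simp only [add_lie, lie_add, smul_lie, lie_smul, lie_self, lie_matX_matY, h, smul_zero,
        add_zero]
    rw [h0]
    exact (Submodule.span F {matX a b, matY a b}).zero_mem

/-- The decomposition `J_3(a, b)`, formed with the cube root of unity `u`: the diagonal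
matrices together with `⟨X(uᵏa, uᵏb), Y(uᵏa, uᵏb)⟩` for `k = 0, 1, 2`. -/
def J3 (u a b : F) : Fin 4 → LieSubalgebra F (sl 3 F) :=
  ![diagSubalgebra F, comp a b, comp (u * a) (u * b), comp (u ^ 2 * a) (u ^ 2 * b)]

/-- One invertible matrix diagonalizes every element of `H`. -/
def IsDiagonalizable (H : LieSubalgebra F (sl 3 F)) : Prop :=
  ∃ P : GL (Fin 3) F, ∀ x ∈ H,
    (P.val * (x : Matrix (Fin 3) (Fin 3) F) * P⁻¹.val).IsDiag

end JThree

end ClassicalOD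

open ClassicalOD
namespace ClassicalOD

section Transport

variable {F L : Type*} [Field F] [LieRing L] [LieAlgebra F L]

lemma iSupIndep_rootSpace (H : LieSubalgebra F L) [IsLieAbelian H] :
    iSupIndep (fun α : Module.Dual F H => rootSpace H α) := by
  have h := LieModule.iSupIndep_genWeightSpace F H L
  rw [← LieSubmodule.iSupIndep_toSubmodule] at h
  have hinj : Function.Injective (fun (α : Module.Dual F H) (h : H) => -α h) := by
    intro α β hαβ
    ext h
    exact neg_injective (congrFun hαβ h)
  refine (h.comp hinj).mono fun α x hx => ?_
  refine LieModule.weightSpace_le_genWeightSpace L _ ?_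
  rw [LieModule.mem_weightSpace]
  intro h
  rw [LieSubalgebra.coe_bracket_of_module, ← lie_skew, hx h, neg_smul]

lemma mem_map_equiv (φ : L ≃ₗ⁅F⁆ L) (H : LieSubalgebra F L) (x : L) :
    x ∈ H.map φ.toLieHom ↔ φ.symm x ∈ H := by
  rw [LieSubalgebra.mem_map]
  constructor
  · rintro ⟨y, hy, rfl⟩
    simpa using hy
  · intro h
    exact ⟨_, h, by simp⟩

/-- The identification of a subalgebra with its image under an automorphism. -/
noncomputable def mapEquiv (φ : L ≃ₗ⁅F⁆ L) (H : LieSubalgebra F L) :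
    H ≃ₗ[F] H.map φ.toLieHom :=
  (LieEquiv.lieSubalgebraMap H φ).toLinearEquiv

lemma coe_mapEquiv (φ : L ≃ₗ⁅F⁆ L) (H : LieSubalgebra F L) (h : H) :
    (mapEquiv φ H h : L) = φ h := rfl

lemma coe_mapEquiv_symm (φ : L ≃ₗ⁅F⁆ L) (H : LieSubalgebra F L) (h : H.map φ.toLieHom) :
    ((mapEquiv φ H).symm h : L) = φ.symm h := by
  rw [← φ.symm_apply_apply (((mapEquiv φ H).symm h : H) : L), ← coe_mapEquiv,
    LinearEquiv.apply_symm_apply]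

lemma rootSpace_map (φ : L ≃ₗ⁅F⁆ L) (H : LieSubalgebra F L)
    (α : Module.Dual F (H.map φ.toLieHom)) :
    rootSpace (H.map φ.toLieHom) α =
      (rootSpace H ((mapEquiv φ H).dualMap α)).map φ.toLinearEquiv.toLinearMap := by
  ext x
  rw [Submodule.mem_map_equiv]
  constructor
  · intro hx h
    have := hx (mapEquiv φ H h)
    rw [coe_mapEquiv] at this
    apply φ.injective
    change φ ⁅φ.symm x, (h : L)⁆ = φ (α (mapEquiv φ H h) • φ.symm x)
    rw [LieEquiv.map_lie, map_smul, LieEquiv.apply_symm_apply, this]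
  · intro hx h
    have := hx ((mapEquiv φ H).symm h)
    rw [coe_mapEquiv_symm] at this
    apply φ.symm.injective
    have h2 : ⁅φ.symm x, φ.symm (h : L)⁆ =
      α (mapEquiv φ H ((mapEquiv φ H).symm h)) • φ.symm x := this
    rwa [LinearEquiv.apply_symm_apply, ← LieEquiv.map_lie, ← map_smul] at h2

lemma isRoot_map (φ : L ≃ₗ⁅F⁆ L) (H : LieSubalgebra F L)
    (α : Module.Dual F (H.map φ.toLieHom)) :
    IsRoot (H.map φ.toLieHom) α ↔ IsRoot H ((mapEquiv φ H).dualMap α) := by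
  rw [IsRoot, IsRoot, rootSpace_map, Ne, Ne, 
    (Submodule.map_injective_of_injective φ.toLinearEquiv.injective).eq_iff' (Submodule.map_bot _)]

lemma self_normalizing_map (φ : L ≃ₗ⁅F⁆ L) {H : LieSubalgebra F L} (hH : H.normalizer = H) :
    (H.map φ.toLieHom).normalizer = H.map φ.toLieHom := by
  refine le_antisymm (fun x hx => ?_) (LieSubalgebra.le_normalizer _)
  rw [mem_map_equiv, ← hH, LieSubalgebra.mem_normalizer_iff]
  intro y hy
  have := (LieSubalgebra.mem_normalizer_iff _ _).1 hx (φ y) ⟨y, hy, rfl⟩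
  rwa [mem_map_equiv, LieEquiv.map_lie, LieEquiv.symm_apply_apply] at this

lemma isLieAbelian_map (φ : L ≃ₗ⁅F⁆ L) {H : LieSubalgebra F L} (hH : IsLieAbelian H) :
    IsLieAbelian (H.map φ.toLieHom) :=
  (lie_abelian_iff_equiv_lie_abelian (LieEquiv.lieSubalgebraMap H φ)).1 hH

lemma isCartanSubalgebra_of_isLieAbelian {H : LieSubalgebra F L} (h : IsLieAbelian H)
    (hn : H.normalizer = H) : H.IsCartanSubalgebra :=
  ⟨inferInstance, hn⟩

lemma lie_eq_zero_of_isLieAbelian {H : LieSubalgebra F L} (h : IsLieAbelian H) {x y : L}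
    (hx : x ∈ H) (hy : y ∈ H) : ⁅x, y⁆ = 0 :=
  congrArg Subtype.val (h.trivial ⟨x, hx⟩ ⟨y, hy⟩)

/-- An abelian self-normalizing subalgebra is maximal among abelian subalgebras. -/
lemma eq_of_le_of_isLieAbelian {H K : LieSubalgebra F L} (hn : H.normalizer = H) (hle : H ≤ K)
    (hK : IsLieAbelian K) : H = K := by
  refine le_antisymm hle fun x hx => ?_
  rw [← hn, LieSubalgebra.mem_normalizer_iff]
  intro y hy
  rw [lie_eq_zero_of_isLieAbelian hK hx (hle hy)]
  exact H.zero_mem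

lemma IsClassicalCartan.map {H : LieSubalgebra F L} (hH : IsClassicalCartan H)
    (φ : L ≃ₗ⁅F⁆ L) : IsClassicalCartan (H.map φ.toLieHom) where
  center_eq_bot := hH.center_eq_bot
  derived_eq_top := hH.derived_eq_top
  cartan := isCartanSubalgebra_of_isLieAbelian (isLieAbelian_map φ hH.abelian)
    (self_normalizing_map φ hH.cartan.self_normalizing)
  abelian := isLieAbelian_map φ hH.abelian
  independent :=
    have := isLieAbelian_map φ hH.abelian
    iSupIndep_rootSpace _
  spanning := by
    simp_rw [rootSpace_map]
    rw [← Submodule.map_iSup,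
      (mapEquiv φ H).dualMap.surjective.iSup_comp (fun α => rootSpace H α), hH.spanning,
      Submodule.map_top, LinearMap.range_eq_top]
    exact φ.toLinearEquiv.surjective
  bracket_one_dim := by
    intro α hα hr
    have h := hH.bracket_one_dim ((mapEquiv φ H).dualMap α)
      (by simpa using hα) ((isRoot_map φ H α).1 hr)
    have hs : {z : L | ∃ x ∈ rootSpace (H.map φ.toLieHom) α,
        ∃ y ∈ rootSpace (H.map φ.toLieHom) (-α), z = ⁅x, y⁆} =
        φ.toLinearEquiv.toLinearMap '' {z : L | ∃ x ∈ rootSpace H ((mapEquiv φ H).dualMap α),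
          ∃ y ∈ rootSpace H (-(mapEquiv φ H).dualMap α), z = ⁅x, y⁆} := by
      ext z
      simp only [rootSpace_map, map_neg, Submodule.mem_map]
      constructor
      · rintro ⟨_, ⟨x, hx, rfl⟩, _, ⟨y, hy, rfl⟩, rfl⟩
        exact ⟨_, ⟨x, hx, y, hy, rfl⟩, LieEquiv.map_lie φ x y⟩
      · rintro ⟨_, ⟨x, hx, y, hy, rfl⟩, rfl⟩
        exact ⟨_, ⟨x, hx, rfl⟩, _, ⟨y, hy, rfl⟩, LieEquiv.map_lie φ x y⟩
    rw [← h, hs, ← Submodule.map_span]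
    exact LinearEquiv.finrank_map_eq φ.toLinearEquiv _
  string := by
    intro α β hα hβ h0
    obtain ⟨k, h1, h2, h3⟩ := hH.string _ _ ((isRoot_map φ H α).1 hα) ((isRoot_map φ H β).1 hβ)
      (by simpa using h0)
    refine ⟨k, h1, h2, ?_⟩
    rwa [isRoot_map, map_add, map_nsmul]

end Transport
section Torus

variable {F : Type*} [Field F]

lemma natCast_ne_zero_of_lt_ringChar {n : ℕ} (h0 : n ≠ 0) (h : n < ringChar F) : (n : F) ≠ 0 := by
  intro hn
  exact absurd (Nat.le_of_dvd (Nat.pos_of_ne_zero h0) ((ringChar.spec F n).1 hn)) (by omega)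

lemma sl_trace (x : sl 3 F) : x.1 0 0 + x.1 1 1 + x.1 2 2 = 0 := by
  have h : Matrix.trace x.1 = 0 := x.2
  rwa [Matrix.trace, Fin.sum_univ_three] at h

/-- The traceless diagonal matrix with prescribed entries. -/
def diagEl (d : Fin 3 → F) (hd : d 0 + d 1 + d 2 = 0) : diagSubalgebra F :=
  ⟨⟨Matrix.diagonal d, by
    simpa [LieAlgebra.SpecialLinear.sl, Fin.sum_univ_three] using hd⟩, Matrix.isDiag_diagonal d⟩

lemma diagSubalgebra_ext_diagEl (h : diagSubalgebra F) :
    h = diagEl (fun i => h.1.1 i i) (sl_trace h.1) := by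
  apply Subtype.ext
  apply Subtype.ext
  exact (Matrix.IsDiag.diagonal_diag h.2).symm

lemma lie_diag_apply (x : sl 3 F) (h : diagSubalgebra F) (i j : Fin 3) :
    (⁅x, h.1⁆ : sl 3 F).1 i j = (h.1.1 j j - h.1.1 i i) * x.1 i j := by
  rw [diagSubalgebra_ext_diagEl h, LieAlgebra.SpecialLinear.sl_bracket]
  simp [diagEl]
  ring

/-- The element `3 E_dd - 1` of the torus. -/
def testEl (d : Fin 3) : diagSubalgebra F :=
  diagEl (fun i => if i = d then 2 else -1) (by fin_cases d <;> simp <;> ring)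

lemma testEl_apply (d i : Fin 3) :
    (testEl d : diagSubalgebra F).1.1 i i = 3 * (if i = d then 1 else 0) - 1 := by
  simp only [testEl, diagEl, Matrix.diagonal_apply_eq]
  split_ifs <;> ring

/-- The functional `h ↦ h_j - h_i` on the torus. -/
def eps (i j : Fin 3) : Module.Dual F (diagSubalgebra F) where
  toFun h := h.1.1 j j - h.1.1 i i
  map_add' x y := by
    change x.1.1 j j + y.1.1 j j - (x.1.1 i i + y.1.1 i i) = _
    ring
  map_smul' c x := by
    change c * x.1.1 j j - c * x.1.1 i i = c * (x.1.1 j j - x.1.1 i i)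
    ring

lemma eps_apply (i j : Fin 3) (h : diagSubalgebra F) : eps i j h = h.1.1 j j - h.1.1 i i := rfl

lemma eps_neg (i j : Fin 3) : -(eps i j : Module.Dual F (diagSubalgebra F)) = eps j i := by
  ext h
  simp [eps_apply]

lemma eps_self (i : Fin 3) : (eps i i : Module.Dual F (diagSubalgebra F)) = 0 := by
  ext h
  simp [eps_apply]

lemma eps_testEl (i j d : Fin 3) : eps i j (testEl d : diagSubalgebra F) =
    3 * ((if j = d then 1 else 0) - (if i = d then 1 else 0)) := by
  rw [eps_apply, testEl_apply, testEl_apply]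
  ring

lemma mem_rootSpace_diag {α : Module.Dual F (diagSubalgebra F)} {x : sl 3 F} :
    x ∈ rootSpace (diagSubalgebra F) α ↔ ∀ i j, x.1 i j ≠ 0 → α = eps i j := by
  constructor
  · intro hx i j hij
    ext h
    have h1 := congrArg (fun y : sl 3 F => y.1 i j) (hx h)
    simp only [lie_diag_apply] at h1
    exact (mul_right_cancel₀ hij h1).symm
  · intro hx h
    apply Subtype.ext
    ext i j
    rw [lie_diag_apply]
    by_cases hij : x.1 i j = 0
    · simp [hij]
    · simp [hx i j hij, eps_apply]

lemma single_mem_rootSpace {i j : Fin 3} (hij : i ≠ j) (c : F) :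
    LieAlgebra.SpecialLinear.single i j hij c ∈ rootSpace (diagSubalgebra F) (eps i j) := by
  rw [mem_rootSpace_diag]
  intro k l h
  rw [LieAlgebra.SpecialLinear.val_single, Matrix.single_apply] at h
  obtain ⟨rfl, rfl⟩ : i = k ∧ j = l := by
    by_contra h'
    exact h (if_neg h')
  rfl

lemma exists_eps_of_isRoot {α : Module.Dual F (diagSubalgebra F)}
    (h : IsRoot (diagSubalgebra F) α) : ∃ i j, α = eps i j := by
  obtain ⟨x, hx, h0⟩ := Submodule.exists_mem_ne_zero_of_ne_bot h
  by_contra! hne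
  apply h0
  apply Subtype.ext
  ext i j
  by_contra hij
  exact hne i j (mem_rootSpace_diag.1 hx i j hij)

lemma eps_inj (h2 : (2 : F) ≠ 0) (h3 : (3 : F) ≠ 0) {i j k l : Fin 3} (hij : i ≠ j)
    (h : (eps i j : Module.Dual F (diagSubalgebra F)) = eps k l) : k = i ∧ l = j := by
  have e (d : Fin 3) := mul_left_cancel₀ h3
    ((eps_testEl i j d).symm.trans ((DFunLike.congr_fun h (testEl d)).trans (eps_testEl k l d)))
  have ei := e i
  have ej := e j
  rw [if_pos rfl, if_neg hij.symm] at ei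
  rw [if_pos rfl, if_neg hij] at ej
  constructor
  · by_contra hki
    rw [if_neg hki] at ei
    split_ifs at ei
    · exact h2 (by linear_combination -ei)
    · exact one_ne_zero (α := F) (by linear_combination -ei)
  · by_contra hlj
    rw [if_neg hlj] at ej
    split_ifs at ej
    · exact h2 (by linear_combination ej)
    · exact one_ne_zero (α := F) (by linear_combination ej)

/-- In a three-term arithmetic progression of roots the middle term vanishes, or the progression
is constant. -/
lemma eps_progression (h2 : (2 : F) ≠ 0) (h3 : (3 : F) ≠ 0) {a b c d e f : Fin 3}
    (h : (eps a b + eps e f : Module.Dual F (diagSubalgebra F)) = (2 : F) • eps c d) :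
    c = d ∨ (a = c ∧ b = d) := by
  by_contra! hne
  obtain ⟨hcd, hne⟩ := hne
  have key (m : Fin 3) : ((if b = m then 1 else 0) - (if a = m then 1 else 0) : F) +
      ((if f = m then 1 else 0) - (if e = m then 1 else 0)) =
      2 * ((if d = m then 1 else 0) - (if c = m then 1 else 0)) := by
    have := DFunLike.congr_fun h (testEl m)
    simp only [LinearMap.add_apply, LinearMap.smul_apply, eps_testEl, smul_eq_mul] at this
    apply mul_left_cancel₀ h3
    linear_combination this
  have hd := key d
  have hc := key c
  rw [if_pos rfl, if_neg hcd] at hd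
  rw [if_pos rfl, if_neg hcd.symm] at hc
  have h4 : (4 : F) ≠ 0 := by
    rw [show (4 : F) = 2 * 2 by norm_num]
    exact mul_ne_zero h2 h2
  have hbd : b = d := by
    by_contra hb
    rw [if_neg hb] at hd
    split_ifs at hd
    all_goals first
      | exact h4 (by linear_combination -hd)
      | exact h3 (by linear_combination -hd)
      | exact h2 (by linear_combination -hd)
      | exact one_ne_zero (α := F) (by linear_combination -hd)
  have hac : a = c := by
    by_contra hb
    rw [if_neg hb] at hc
    split_ifs at hc
    all_goals first
      | exact h4 (by linear_combination hc)
      | exact h3 (by linear_combination hc)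
      | exact h2 (by linear_combination hc)
      | exact one_ne_zero (α := F) (by linear_combination hc)
  exact hne hac hbd

lemma isLieAbelian_diagSubalgebra : IsLieAbelian (diagSubalgebra F) := by
  refine ⟨fun x y => ?_⟩
  apply Subtype.ext
  apply Subtype.ext
  ext i j
  change (⁅x.1, y.1⁆ : sl 3 F).1 i j = 0
  rw [lie_diag_apply]
  by_cases hij : i = j
  · simp [hij]
  · have : x.1.1 i j = 0 := x.2 hij
    simp [this]

lemma diagSubalgebra_normalizer (h3 : (3 : F) ≠ 0) :
    (diagSubalgebra F).normalizer = diagSubalgebra F := by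
  refine le_antisymm (fun x hx => ?_) (LieSubalgebra.le_normalizer _)
  intro i j hij
  have h := (LieSubalgebra.mem_normalizer_iff _ _).1 hx _ (testEl j).2 hij
  change (⁅x, (testEl j).1⁆ : sl 3 F).1 i j = 0 at h
  rw [lie_diag_apply, testEl_apply, testEl_apply, if_pos rfl, if_neg hij] at h
  have h' : (3 : F) * x.1 i j = 0 := by linear_combination h
  exact (mul_eq_zero.1 h').resolve_left h3

/-- A submodule of `sl 3 F` containing the matrix units off the diagonal and the diagonal
matrices is everything. -/
lemma eq_top_of_single_mem {S : Submodule F (sl 3 F)}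
    (hs : ∀ i j (hij : i ≠ j) (c : F), LieAlgebra.SpecialLinear.single i j hij c ∈ S)
    (hd : ∀ h : diagSubalgebra F, h.1 ∈ S) : S = ⊤ := by
  rw [eq_top_iff]
  intro x _
  have e : x = (diagEl (fun i => x.1 i i) (sl_trace x)).1
      + LieAlgebra.SpecialLinear.single 0 1 (by decide) (x.1 0 1)
      + LieAlgebra.SpecialLinear.single 0 2 (by decide) (x.1 0 2)
      + LieAlgebra.SpecialLinear.single 1 0 (by decide) (x.1 1 0)
      + LieAlgebra.SpecialLinear.single 1 2 (by decide) (x.1 1 2)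
      + LieAlgebra.SpecialLinear.single 2 0 (by decide) (x.1 2 0)
      + LieAlgebra.SpecialLinear.single 2 1 (by decide) (x.1 2 1) := by
    apply Subtype.ext
    ext i j
    simp only [AddMemClass.coe_add, LieAlgebra.SpecialLinear.val_single, diagEl]
    fin_cases i <;> fin_cases j <;> simp
  rw [e]
  exact S.add_mem (S.add_mem (S.add_mem (S.add_mem (S.add_mem (S.add_mem (hd _) (hs _ _ _ _))
    (hs _ _ _ _)) (hs _ _ _ _)) (hs _ _ _ _)) (hs _ _ _ _)) (hs _ _ _ _)

lemma lie_single_single {i j k : Fin 3} (hij : i ≠ j) (hjk : j ≠ k) (hik : i ≠ k) (c : F) :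
    (⁅LieAlgebra.SpecialLinear.single i j hij c, LieAlgebra.SpecialLinear.single j k hjk 1⁆
      : sl 3 F) = LieAlgebra.SpecialLinear.single i k hik c := by
  apply Subtype.ext
  rw [LieAlgebra.SpecialLinear.sl_bracket]
  simp [Matrix.single_mul_single_of_ne _ _ _ _ hik.symm]

lemma lie_single_single_swap {i j : Fin 3} (hij : i ≠ j) (a b : F) :
    (⁅LieAlgebra.SpecialLinear.single i j hij a, LieAlgebra.SpecialLinear.single j i hij.symm b⁆
      : sl 3 F) = LieAlgebra.SpecialLinear.singleSubSingle i j (a * b) := by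
  apply Subtype.ext
  rw [LieAlgebra.SpecialLinear.sl_bracket]
  simp [mul_comm]

lemma sl_center_eq_bot (h3 : (3 : F) ≠ 0) : LieAlgebra.center F (sl 3 F) = ⊥ := by
  rw [eq_bot_iff]
  intro x hx
  have hx' : ∀ y : sl 3 F, ⁅y, x⁆ = 0 := hx
  have hc : x.1 ∈ Set.range (Matrix.scalar (Fin 3)) := by
    apply Matrix.mem_range_scalar_of_commute_single
    intro i j hij
    have := congrArg Subtype.val (hx' (LieAlgebra.SpecialLinear.single i j hij 1))
    rw [LieAlgebra.SpecialLinear.sl_bracket] at this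
    exact sub_eq_zero.1 this
  obtain ⟨c, hc⟩ := hc
  have ht := sl_trace x
  rw [← hc] at ht
  have hc0 : c = 0 := by
    simp only [Matrix.scalar_apply, Matrix.diagonal_apply_eq] at ht
    have : 3 * c = 0 := by linear_combination ht
    exact (mul_eq_zero.1 this).resolve_left h3
  rw [LieSubmodule.mem_bot]
  apply Subtype.ext
  rw [← hc, hc0]
  simp

lemma sl_derived_eq_top :
    ⁅(⊤ : LieIdeal F (sl 3 F)), (⊤ : LieIdeal F (sl 3 F))⁆ = ⊤ := by
  rw [← LieSubmodule.toSubmodule_inj, LieSubmodule.top_toSubmodule]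
  have hmem (x y : sl 3 F) :
      ⁅x, y⁆ ∈ (⁅(⊤ : LieIdeal F (sl 3 F)), (⊤ : LieIdeal F (sl 3 F))⁆).toSubmodule :=
    LieSubmodule.lie_mem_lie (LieSubmodule.mem_top x) (LieSubmodule.mem_top y)
  apply eq_top_of_single_mem
  · intro i j hij c
    obtain ⟨k, hik, hkj⟩ : ∃ k : Fin 3, i ≠ k ∧ k ≠ j := by
      revert i j
      decide
    rw [← lie_single_single hik hkj hij c]
    exact hmem _ _
  · intro h
    have e : h.1 = LieAlgebra.SpecialLinear.singleSubSingle 0 1 (h.1.1 0 0 * 1)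
        + LieAlgebra.SpecialLinear.singleSubSingle 2 1 (h.1.1 2 2 * 1) := by
      have ht := sl_trace h.1
      rw [diagSubalgebra_ext_diagEl h]
      apply Subtype.ext
      ext i j
      simp only [AddMemClass.coe_add, LieAlgebra.SpecialLinear.val_singleSubSingle, diagEl]
      fin_cases i <;> fin_cases j <;> simp
      linear_combination ht
    rw [e, ← lie_single_single_swap (by decide), ← lie_single_single_swap (by decide)]
    exact Submodule.add_mem _ (hmem _ _) (hmem _ _)

lemma rootSpace_eps (h2 : (2 : F) ≠ 0) (h3 : (3 : F) ≠ 0) {i j : Fin 3} (hij : i ≠ j)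
    {x : sl 3 F} : x ∈ rootSpace (diagSubalgebra F) (eps i j) ↔
      x = LieAlgebra.SpecialLinear.single i j hij (x.1 i j) := by
  constructor
  · intro hx
    apply Subtype.ext
    ext k l
    rw [LieAlgebra.SpecialLinear.val_single, Matrix.single_apply]
    split_ifs with h
    · rw [h.1, h.2]
    · by_contra hkl
      have := eps_inj h2 h3 hij (mem_rootSpace_diag.1 hx k l hkl)
      exact h ⟨this.1.symm, this.2.symm⟩
  · intro hx
    rw [hx]
    exact single_mem_rootSpace hij _

lemma isClassicalCartan_diagSubalgebra (hchar : 3 < ringChar F) :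
    IsClassicalCartan (diagSubalgebra F) := by
  have h2 : (2 : F) ≠ 0 := by
    exact_mod_cast natCast_ne_zero_of_lt_ringChar (F := F) two_ne_zero (by omega)
  have h3 : (3 : F) ≠ 0 := by
    exact_mod_cast natCast_ne_zero_of_lt_ringChar (F := F) three_ne_zero hchar
  have hab : IsLieAbelian (diagSubalgebra F) := isLieAbelian_diagSubalgebra
  refine ⟨sl_center_eq_bot h3, sl_derived_eq_top,
    isCartanSubalgebra_of_isLieAbelian hab (diagSubalgebra_normalizer h3), hab,
    iSupIndep_rootSpace _, ?_, ?_, ?_⟩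
  · apply eq_top_of_single_mem
    · intro i j hij c
      exact Submodule.mem_iSup_of_mem _ (single_mem_rootSpace hij c)
    · intro h
      refine Submodule.mem_iSup_of_mem 0 fun k => ?_
      rw [lie_eq_zero_of_isLieAbelian hab h.2 k.2]
      simp
  · intro α hα hr
    obtain ⟨i, j, rfl⟩ := exists_eps_of_isRoot hr
    have hij : i ≠ j := by
      rintro rfl
      exact hα (eps_self i)
    rw [eps_neg]
    have hs : Submodule.span F {z : sl 3 F | ∃ x ∈ rootSpace (diagSubalgebra F) (eps i j),
        ∃ y ∈ rootSpace (diagSubalgebra F) (eps j i), z = ⁅x, y⁆} =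
        Submodule.span F {LieAlgebra.SpecialLinear.singleSubSingle i j (1 : F)} := by
      apply le_antisymm
      · rw [Submodule.span_le]
        rintro _ ⟨x, hx, y, hy, rfl⟩
        rw [(rootSpace_eps h2 h3 hij).1 hx, (rootSpace_eps h2 h3 hij.symm).1 hy,
          lie_single_single_swap, ← mul_one (x.1 i j * y.1 j i), ← smul_eq_mul, map_smul]
        exact Submodule.smul_mem _ _ (Submodule.mem_span_singleton_self _)
      · rw [Submodule.span_singleton_le_iff_mem]
        apply Submodule.subset_span
        exact ⟨_, single_mem_rootSpace hij 1, _, single_mem_rootSpace hij.symm 1, by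
          rw [lie_single_single_swap, one_mul]⟩
    rw [hs]
    apply finrank_span_singleton
    intro h0
    have := congrArg (fun y : sl 3 F => y.1 i i) h0
    simp [hij.symm] at this
  · intro α β hα hβ h0
    by_contra! hk
    have hk1 := hk 1 le_rfl (by omega)
    have hk2 := hk 2 (by omega) (by omega)
    have hk3 := hk 3 (by omega) (by omega)
    obtain ⟨a, b, ha⟩ := exists_eps_of_isRoot hα
    obtain ⟨c, d, hc⟩ := exists_eps_of_isRoot hk1
    obtain ⟨e, f, he⟩ := exists_eps_of_isRoot hk2
    obtain ⟨m, n, hm⟩ := exists_eps_of_isRoot hk3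
    have h1 : α + (1 : ℕ) • β = 0 := by
      rcases eps_progression (F := F) h2 h3 (a := a) (b := b) (c := c) (d := d) (e := e) (f := f)
        (by rw [← ha, ← hc, ← he]; module) with rfl | ⟨rfl, rfl⟩
      · rw [hc, eps_self]
      · rw [← ha] at hc
        exact absurd (by simpa using hc) h0
    have h2 : α + (2 : ℕ) • β = 0 := by
      rcases eps_progression (F := F) h2 h3 (a := c) (b := d) (c := e) (d := f) (e := m) (f := n)
        (by rw [← hc, ← he, ← hm]; module) with rfl | ⟨rfl, rfl⟩
      · rw [he, eps_self]
      · rw [← hc, two_nsmul, one_nsmul, ← add_assoc] at he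
        exact absurd (by simpa using he) h0
    apply h0
    rw [two_nsmul, ← add_assoc] at h2
    rw [one_nsmul] at h1
    rwa [h1, zero_add] at h2

end Torus
section Conjugation

variable {F : Type*} [Field F]

/-- Conjugation by an invertible matrix, as an automorphism of `sl 3 F`. -/
def conj (P : GL (Fin 3) F) : sl 3 F ≃ₗ⁅F⁆ sl 3 F where
  toFun x := ⟨P.val * x.1 * P⁻¹.val, by
    change Matrix.trace (P.val * x.1 * P⁻¹.val) = 0
    rw [Matrix.trace_mul_comm, ← mul_assoc, ← Units.val_mul, inv_mul_cancel, Units.val_one, one_mul]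
    exact x.2⟩
  map_add' x y := Subtype.ext (by simp [mul_add, add_mul])
  map_smul' c x := Subtype.ext (by simp)
  map_lie' {x y} := by
    apply Subtype.ext
    simp only [LieAlgebra.SpecialLinear.sl_bracket]
    have h : P⁻¹.val * P.val = 1 := by rw [← Units.val_mul, inv_mul_cancel, Units.val_one]
    have e (a b : Matrix (Fin 3) (Fin 3) F) : P.val * a * P⁻¹.val * (P.val * b * P⁻¹.val) =
        P.val * (a * b) * P⁻¹.val := by
      calc _ = P.val * a * (P⁻¹.val * P.val) * b * P⁻¹.val := by noncomm_ring
        _ = _ := by rw [h]; noncomm_ring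
    rw [e, e]
    noncomm_ring
  invFun x := ⟨P⁻¹.val * x.1 * P.val, by
    change Matrix.trace (P⁻¹.val * x.1 * P.val) = 0
    rw [Matrix.trace_mul_comm, ← mul_assoc, ← Units.val_mul, mul_inv_cancel, Units.val_one, one_mul]
    exact x.2⟩
  left_inv x := Subtype.ext (by simp [mul_assoc])
  right_inv x := Subtype.ext (by simp [mul_assoc])

lemma conj_apply (P : GL (Fin 3) F) (x : sl 3 F) : (conj P x).1 = P.val * x.1 * P⁻¹.val := rfl

lemma conj_symm (P : GL (Fin 3) F) : (conj P).symm = conj P⁻¹ := by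
  ext x : 1
  apply Subtype.ext
  rw [conj_apply, inv_inv]
  rfl

lemma conj_conj (P Q : GL (Fin 3) F) (x : sl 3 F) : conj P (conj Q x) = conj (P * Q) x := by
  apply Subtype.ext
  simp only [conj_apply, mul_inv_rev, Units.val_mul, mul_assoc]

lemma map_conj_conj (P Q : GL (Fin 3) F) (H : LieSubalgebra F (sl 3 F)) :
    (H.map (conj Q).toLieHom).map (conj P).toLieHom = H.map (conj (P * Q)).toLieHom := by
  ext x
  simp only [mem_map_equiv, conj_symm, conj_conj, mul_inv_rev]

lemma map_conj_one (H : LieSubalgebra F (sl 3 F)) : H.map (conj 1).toLieHom = H := by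
  ext x
  rw [mem_map_equiv, conj_symm]
  have : conj (1⁻¹ : GL (Fin 3) F) x = x := Subtype.ext (by simp [conj_apply])
  rw [this]

lemma mul_single_mul_apply (a b : Matrix (Fin 3) (Fin 3) F) (i j k l : Fin 3) :
    (a * Matrix.single k l 1 * b : Matrix (Fin 3) (Fin 3) F) i j = a i k * b l j := by
  rw [mul_assoc, Matrix.mul_apply, Finset.sum_eq_single k]
  · simp
  · intro m _ hm
    rw [Matrix.single_mul_apply_of_ne _ _ _ _ _ hm, mul_zero]
  · simp

/-- The Killing form of `sl 3 F` is six times the trace form. -/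
lemma killingForm_sl (x y : sl 3 F) :
    killingForm F (sl 3 F) x y = 6 * Matrix.trace (x.1 * y.1) := by
  rw [killingForm_apply_apply]
  let f : Matrix (Fin 3) (Fin 3) F →ₗ[F] Matrix (Fin 3) (Fin 3) F :=
    { toFun := fun m => x.1 * (y.1 * m - m * y.1) - (y.1 * m - m * y.1) * x.1
      map_add' := fun a b => by noncomm_ring
      map_smul' := fun c a => by
        simp only [mul_smul_comm, smul_mul_assoc, ← smul_sub, RingHom.id_apply] }
  have hf (m : Matrix (Fin 3) (Fin 3) F) : 
      f m ∈ LinearMap.ker (Matrix.traceLinearMap (Fin 3) F F) := by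
    change Matrix.trace (x.1 * (y.1 * m - m * y.1) - (y.1 * m - m * y.1) * x.1) = 0
    rw [Matrix.trace_sub, Matrix.trace_mul_comm, sub_self]
  have h : LinearMap.trace F (sl 3 F) (LieAlgebra.ad F (sl 3 F) x ∘ₗ LieAlgebra.ad F (sl 3 F) y) =
      LinearMap.trace F _ f := LinearMap.trace_restrict_eq_of_forall_mem _ f hf
  have hx := sl_trace x
  have hy := sl_trace y
  refine h.trans ?_
  rw [LinearMap.trace_eq_matrix_trace F (Matrix.stdBasis F (Fin 3) (Fin 3)), Matrix.trace,
    Fintype.sum_prod_type]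
  simp only [Matrix.diag_apply, LinearMap.toMatrix_apply, Matrix.stdBasis_eq_single]
  have hr (m : Matrix (Fin 3) (Fin 3) F) (i j : Fin 3) :
      (Matrix.stdBasis F (Fin 3) (Fin 3)).repr m (i, j) = m i j := by
    simp [Matrix.stdBasis]
  have hent (i j : Fin 3) : f (Matrix.single i j 1) i j =
      (x.1 * y.1) i i - x.1 i i * y.1 j j - y.1 i i * x.1 j j + (y.1 * x.1) j j := by
    change (x.1 * (y.1 * Matrix.single i j 1 - Matrix.single i j 1 * y.1)
      - (y.1 * Matrix.single i j 1 - Matrix.single i j 1 * y.1) * x.1 :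
        Matrix (Fin 3) (Fin 3) F) i j = _
    rw [mul_sub, sub_mul]
    simp only [Matrix.sub_apply, ← mul_assoc, Matrix.mul_single_apply_same, mul_one]
    rw [mul_assoc (Matrix.single i j 1), Matrix.single_mul_apply_same]
    rw [mul_single_mul_apply, mul_single_mul_apply]
    ring
  simp only [hr, hent, Fin.sum_univ_three, Matrix.trace, Matrix.diag_apply, Matrix.mul_apply]
  linear_combination (-2 * (y.1 0 0 + y.1 1 1 + y.1 2 2)) * hx

end Conjugation

section Diagonalization

variable {F : Type*} [Field F]
open Matrix

lemma mulVec_root {H : LieSubalgebra F (sl 3 F)} {α : Module.Dual F H} {x : sl 3 F}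
    (hx : x ∈ rootSpace H α) (h : H) : x.1 * h.1.1 = h.1.1 * x.1 + α h • x.1 := by
  have := congrArg Subtype.val (hx h)
  rw [LieAlgebra.SpecialLinear.sl_bracket] at this
  exact sub_eq_iff_eq_add'.1 this

lemma det_eq_zero_of_mem_rootSpace (h3 : (3 : F) ≠ 0) {H : LieSubalgebra F (sl 3 F)}
    {α : Module.Dual F H} (hα : α ≠ 0) {x : sl 3 F} (hx : x ∈ rootSpace H α) : x.1.det = 0 := by
  by_contra hdet
  have hu : IsUnit x.1.det := isUnit_iff_ne_zero.2 hdet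
  apply hα
  ext h
  have e := mulVec_root hx h
  have h1 : x.1 * h.1.1 * x.1⁻¹ = h.1.1 + α h • (1 : Matrix (Fin 3) (Fin 3) F) := by
    rw [e, add_mul, mul_nonsing_inv_cancel_right _ _ hu, smul_mul_assoc, mul_nonsing_inv _ hu]
  have h2 := congrArg Matrix.trace h1
  rw [Matrix.trace_mul_comm, nonsing_inv_mul_cancel_left _ _ hu, Matrix.trace_add,
    Matrix.trace_smul, Matrix.trace_one, left_eq_add] at h2
  simp only [Fintype.card_fin, smul_eq_mul] at h2
  exact (mul_eq_zero.1 h2).resolve_right (by exact_mod_cast h3)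

lemma exists_root_ne_zero {H : LieSubalgebra F (sl 3 F)} (hH : IsClassicalCartan H) :
    ∃ α : Module.Dual F H, α ≠ 0 ∧ IsRoot H α := by
  by_contra! hne
  have htop : rootSpace H 0 = ⊤ := by
    rw [eq_top_iff, ← hH.spanning]
    refine iSup_le fun α => ?_
    by_cases hα : α = 0
    · rw [hα]
    · rw [not_not.1 (hne α hα)]
      exact bot_le
  have hcomm (x : sl 3 F) (h : H) : ⁅x, h.1⁆ = 0 := by
    have : x ∈ rootSpace H 0 := htop ▸ Submodule.mem_top
    simpa using this h
  have hHbot (y : sl 3 F) (hy : y ∈ H) : y = 0 := by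
    have : y ∈ LieAlgebra.center F (sl 3 F) := fun x => hcomm x ⟨y, hy⟩
    rw [hH.center_eq_bot] at this
    simpa using this
  have hmem (x : sl 3 F) : x ∈ H := by
    rw [← hH.cartan.self_normalizing, LieSubalgebra.mem_normalizer_iff]
    intro y hy
    rw [hHbot y hy, lie_zero]
    exact H.zero_mem
  have := congrArg (fun y : sl 3 F => y.1 0 1)
    (hHbot _ (hmem (LieAlgebra.SpecialLinear.single 0 1 (by decide) 1)))
  simp at this

/-- The elements of a subalgebra with a nonzero root have a common eigenvector. -/
lemma exists_common_eigenvector (h3 : (3 : F) ≠ 0) {H : LieSubalgebra F (sl 3 F)}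
    {α : Module.Dual F H} (hα : α ≠ 0) (hr : IsRoot H α) :
    ∃ u : Fin 3 → F, u ≠ 0 ∧ ∀ h : H, ∃ c : F, h.1.1 *ᵥ u = c • u := by
  obtain ⟨x, hx, h0⟩ := Submodule.exists_mem_ne_zero_of_ne_bot hr
  have hdet := det_eq_zero_of_mem_rootSpace h3 hα hx
  have line (W : Submodule F (Fin 3 → F)) (hW : Module.finrank F W = 1)
      (hinv : ∀ h : H, ∀ v ∈ W, h.1.1 *ᵥ v ∈ W) :
      ∃ u : Fin 3 → F, u ≠ 0 ∧ ∀ h : H, ∃ c : F, h.1.1 *ᵥ u = c • u := by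
    obtain ⟨u, hu, hspan⟩ := finrank_eq_one_iff'.1 hW
    refine ⟨u, by simpa using hu, fun h => ?_⟩
    obtain ⟨c, hc⟩ := hspan ⟨_, hinv h u u.2⟩
    exact ⟨c, (congrArg Subtype.val hc).symm⟩
  have hsum := LinearMap.finrank_range_add_finrank_ker x.1.mulVecLin
  rw [Module.finrank_fin_fun] at hsum
  have hker : Module.finrank F (LinearMap.ker x.1.mulVecLin) ≠ 0 := by
    intro hk
    rw [Submodule.finrank_eq_zero] at hk
    obtain ⟨v, hv, hv0⟩ := Matrix.exists_mulVec_eq_zero_iff.2 hdet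
    exact hv ((Submodule.mem_bot F).1 (hk ▸ (show v ∈ LinearMap.ker x.1.mulVecLin from hv0)))
  have hran : Module.finrank F (LinearMap.range x.1.mulVecLin) ≠ 0 := by
    intro hk
    rw [Submodule.finrank_eq_zero, LinearMap.range_eq_bot] at hk
    apply h0
    apply Subtype.ext
    exact Matrix.mulVec_injective (funext fun v => by simpa using LinearMap.congr_fun hk v)
  rcases (by omega : Module.finrank F (LinearMap.range x.1.mulVecLin) = 1 ∨
    Module.finrank F (LinearMap.ker x.1.mulVecLin) = 1) with h1 | h1
  · refine line _ h1 ?_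
    rintro h _ ⟨w, rfl⟩
    refine ⟨h.1.1 *ᵥ w - α h • w, ?_⟩
    simp only [Matrix.mulVecLin_apply, Matrix.mulVec_sub, Matrix.mulVec_smul, Matrix.mulVec_mulVec]
    rw [mulVec_root hx h, Matrix.add_mulVec, Matrix.smul_mulVec, add_sub_cancel_right]
  · refine line _ h1 ?_
    intro h v hv
    have hv' : x.1 *ᵥ v = 0 := hv
    change x.1 *ᵥ (h.1.1 *ᵥ v) = 0
    rw [Matrix.mulVec_mulVec, mulVec_root hx h, Matrix.add_mulVec, Matrix.smul_mulVec, hv',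
      ← Matrix.mulVec_mulVec, hv']
    simp

lemma exists_sl_mulVec_eq {u : Fin 3 → F} (hu : u ≠ 0) (w : Fin 3 → F) :
    ∃ (x : sl 3 F) , x.1 *ᵥ u = w := by
  obtain ⟨k, hk⟩ := Function.ne_iff.1 hu
  have hk' : u k ≠ 0 := hk
  obtain ⟨l, hl⟩ := exists_ne k
  refine ⟨⟨Matrix.vecMulVec w (Pi.single k (u k)⁻¹) -
    (w k / u k) • (Matrix.single l l 1 - Matrix.single l k (u l / u k) :
      Matrix (Fin 3) (Fin 3) F), ?_⟩, ?_⟩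
  · change Matrix.trace (_ : Matrix (Fin 3) (Fin 3) F) = 0
    simp [Matrix.trace_vecMulVec, hl, div_eq_mul_inv]
  · ext i
    simp only [Matrix.sub_mulVec, Matrix.smul_mulVec, Matrix.single_mulVec, Pi.sub_apply,
      Pi.smul_apply, Matrix.vecMulVec_mulVec]
    by_cases hi : i = l <;> simp [hi, hk']

lemma span_common_eigenvectors (h3 : (3 : F) ≠ 0) {H : LieSubalgebra F (sl 3 F)}
    (hH : IsClassicalCartan H) :
    ⊤ ≤ Submodule.span F {u : Fin 3 → F | ∀ h : H, ∃ c : F, h.1.1 *ᵥ u = c • u} := by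
  obtain ⟨α, hα, hr⟩ := exists_root_ne_zero hH
  obtain ⟨u, hu, heig⟩ := exists_common_eigenvector h3 hα hr
  intro w _
  obtain ⟨x, rfl⟩ := exists_sl_mulVec_eq hu w
  have hx : x ∈ ⨆ α : Module.Dual F H, rootSpace H α := hH.spanning ▸ Submodule.mem_top
  induction hx using Submodule.iSup_induction' with
  | mem β y hy =>
    apply Submodule.subset_span
    intro h
    obtain ⟨c, hc⟩ := heig h
    refine ⟨c - β h, ?_⟩
    have e : h.1.1 * y.1 = y.1 * h.1.1 - β h • y.1 := by
      rw [mulVec_root hy h, add_sub_cancel_right]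
    rw [Matrix.mulVec_mulVec, e, Matrix.sub_mulVec, ← Matrix.mulVec_mulVec, hc, Matrix.mulVec_smul,
      Matrix.smul_mulVec, sub_smul]
  | zero => simp
  | add y z _ _ hy hz =>
    rw [AddMemClass.coe_add, Matrix.add_mulVec]
    exact Submodule.add_mem _ (hy trivial) (hz trivial)

/-- A classical Cartan subalgebra of `sl 3 F` is diagonalizable. -/
lemma IsClassicalCartan.isDiagonalizable (h3 : (3 : F) ≠ 0) {H : LieSubalgebra F (sl 3 F)}
    (hH : IsClassicalCartan H) : IsDiagonalizable H := by
  have hs := span_common_eigenvectors h3 hH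
  let b₀ := Module.Basis.ofSpan hs
  have hb₀ := Module.Basis.ofSpan_subset hs
  let b : Module.Basis (Fin 3) F (Fin 3 → F) :=
    b₀.reindex (b₀.indexEquiv (Pi.basisFun F (Fin 3)))
  have hb (i : Fin 3) (h : H) : ∃ c : F, h.1.1 *ᵥ b i = c • b i := by
    apply hb₀
    simp [b, b₀]
  choose c hc using hb
  have hdet : IsUnit ((Pi.basisFun F (Fin 3)).toMatrix b) := by
    have := (Pi.basisFun F (Fin 3)).invertibleToMatrix b
    exact isUnit_of_invertible _
  obtain ⟨P, hP⟩ := hdet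
  have hPe (i j : Fin 3) : P.val i j = b j i := by
    rw [hP]
    simp [Module.Basis.toMatrix_apply]
  refine ⟨P⁻¹, fun x hx => ?_⟩
  have e : x.1 * P.val = P.val * Matrix.diagonal (fun j => c j ⟨x, hx⟩) := by
    ext i j
    rw [Matrix.mul_diagonal, hPe]
    have := congrFun (hc j ⟨x, hx⟩) i
    simp only [Pi.smul_apply, smul_eq_mul] at this
    rw [mul_comm, ← this, Matrix.mul_apply]
    simp [Matrix.mulVec, dotProduct, hPe]
  rw [inv_inv, mul_assoc, e, ← mul_assoc, ← Units.val_mul, inv_mul_cancel, Units.val_one, one_mul]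
  exact Matrix.isDiag_diagonal _

/-- Classical Cartan subalgebras of `sl 3 F` are conjugate to the diagonal one. -/
lemma IsClassicalCartan.exists_eq_map_conj (h3 : (3 : F) ≠ 0) {H : LieSubalgebra F (sl 3 F)}
    (hH : IsClassicalCartan H) :
    ∃ P : GL (Fin 3) F, H = (diagSubalgebra F).map (conj P).toLieHom := by
  obtain ⟨P, hP⟩ := hH.isDiagonalizable h3
  refine ⟨P⁻¹, eq_of_le_of_isLieAbelian hH.cartan.self_normalizing (fun x hx => ?_)
    (isLieAbelian_map _ isLieAbelian_diagSubalgebra)⟩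
  rw [mem_map_equiv, conj_symm, inv_inv]
  exact hP x hx

end Diagonalization
section Components

variable {F : Type*} [Field F]

lemma comp_le_iff {a b : F} {K : LieSubalgebra F (sl 3 F)} :
    comp a b ≤ K ↔ matX a b ∈ K ∧ matY a b ∈ K := by
  rw [← LieSubalgebra.toSubmodule_le_toSubmodule]
  change Submodule.span F {matX a b, matY a b} ≤ K.toSubmodule ↔ _
  rw [Submodule.span_le, Set.pair_subset_iff]
  rfl

lemma mem_comp_iff {a b : F} {x : sl 3 F} :
    x ∈ comp a b ↔ ∃ s t : F, s • matX a b + t • matY a b = x :=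
  Submodule.mem_span_pair

lemma matX_mem (a b : F) : matX a b ∈ comp a b := (comp_le_iff.1 le_rfl).1

lemma matY_mem (a b : F) : matY a b ∈ comp a b := (comp_le_iff.1 le_rfl).2

lemma isLieAbelian_comp (a b : F) : IsLieAbelian (comp a b) := by
  refine ⟨fun x y => Subtype.ext ?_⟩
  obtain ⟨s, t, hx⟩ := mem_comp_iff.1 x.2
  obtain ⟨s', t', hy⟩ := mem_comp_iff.1 y.2
  have h : ⁅matY a b, matX a b⁆ = 0 := by rw [← lie_skew, lie_matX_matY, neg_zero]
  change ⁅x.1, y.1⁆ = 0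
  rw [← hx, ← hy]
  simp only [add_lie, lie_add, smul_lie, lie_smul, lie_self, lie_matX_matY, h, smul_zero, add_zero]

lemma comp_apply (a b s t : F) : (s • matX a b + t • matY a b : sl 3 F).1 =
    !![0, s, t; t * (a * b), 0, s * a; s * (a * b), t * b, 0] := by
  ext i j
  rw [AddMemClass.coe_add, SetLike.val_smul, SetLike.val_smul]
  fin_cases i <;> fin_cases j <;> simp [matX, matY]

lemma trace_comp_mul (a b c d s t s' t' : F) :
    Matrix.trace ((s • matX a b + t • matY a b : sl 3 F).1 *
      (s' • matX c d + t' • matY c d : sl 3 F).1) =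
      s * t' * (c * d + a * d + a * b) + t * s' * (a * b + b * c + c * d) := by
  rw [comp_apply, comp_apply, Matrix.trace_fin_three]
  simp [Matrix.mul_apply, Fin.sum_univ_three]
  ring

lemma trace_matX_matY (a b c d : F) :
    Matrix.trace ((matX a b).1 * (matY c d).1) = c * d + a * d + a * b := by
  simpa using trace_comp_mul a b c d 1 0 0 1

lemma trace_matY_matX (a b c d : F) :
    Matrix.trace ((matY a b).1 * (matX c d).1) = a * b + b * c + c * d := by
  simpa using trace_comp_mul a b c d 0 1 1 0

lemma val_eq_diagonal {x : sl 3 F} (hx : x ∈ diagSubalgebra F) :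
    x.1 = Matrix.diagonal (fun i => x.1 i i) :=
  (Matrix.IsDiag.diagonal_diag hx).symm

lemma killingForm_diag_comp {a b : F} {x y : sl 3 F} (hx : x ∈ diagSubalgebra F)
    (hy : y ∈ comp a b) : killingForm F (sl 3 F) x y = 0 := by
  obtain ⟨s, t, rfl⟩ := mem_comp_iff.1 hy
  rw [killingForm_sl, comp_apply, val_eq_diagonal hx]
  simp [Matrix.trace_fin_three]

lemma killingForm_comp_comp {a b : F} (h : a ^ 2 + a * b + b ^ 2 = 0) {x y : sl 3 F}
    (hx : x ∈ comp a a) (hy : y ∈ comp b b) : killingForm F (sl 3 F) x y = 0 := by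
  obtain ⟨s, t, rfl⟩ := mem_comp_iff.1 hx
  obtain ⟨s', t', rfl⟩ := mem_comp_iff.1 hy
  rw [killingForm_sl, trace_comp_mul]
  linear_combination (6 * (s * t' + t * s')) * h

lemma killingForm_comm (x y : sl 3 F) :
    killingForm F (sl 3 F) x y = killingForm F (sl 3 F) y x := by
  rw [killingForm_sl, killingForm_sl, Matrix.trace_mul_comm]

lemma mem_map_conj_of_mul_eq {Q : GL (Fin 3) F} {x : sl 3 F} {d : Fin 3 → F}
    (h : x.1 * Q.val = Q.val * Matrix.diagonal d) :
    x ∈ (diagSubalgebra F).map (conj Q).toLieHom := by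
  rw [mem_map_equiv, conj_symm]
  change (Q⁻¹.val * x.1 * Q⁻¹⁻¹.val).IsDiag
  rw [inv_inv, mul_assoc, h, ← mul_assoc, ← Units.val_mul, inv_mul_cancel, Units.val_one, one_mul]
  exact Matrix.isDiag_diagonal d

lemma one_add_add_sq {u : F} (hu : IsPrimitiveRoot u 3) : 1 + u + u ^ 2 = 0 := by
  have := hu.geom_sum_eq_zero (by norm_num)
  simpa [Finset.sum_range_succ] using this

/-- The centralizer of `matX a a` is `comp a a`. -/
lemma mem_comp_of_lie_matX_eq_zero (h3 : (3 : F) ≠ 0) {a : F} (ha : a ^ 3 = 1) {x : sl 3 F}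
    (h : ⁅x, matX a a⁆ = 0) : x ∈ comp a a := by
  have h' : x.1 * (matX a a).1 = (matX a a).1 * x.1 := by
    have := congrArg Subtype.val h
    rw [LieAlgebra.SpecialLinear.sl_bracket] at this
    exact sub_eq_zero.1 this
  have e (i j : Fin 3) := congrFun (congrFun h' i) j
  have e00 := e 0 0
  have e01 := e 0 1
  have e02 := e 0 2
  have e10 := e 1 0
  have e11 := e 1 1
  have e12 := e 1 2
  have ht := sl_trace x
  simp [matX, Matrix.mul_apply, Fin.sum_univ_three] at e00 e01 e02 e10 e11 e12
  have ha0 : a ≠ 0 := by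
    rintro rfl
    simp at ha
  have h22 : x.1 1 1 = x.1 2 2 := mul_left_cancel₀ ha0 (by linear_combination e12)
  have h00 : x.1 0 0 = 0 :=
    (mul_eq_zero.1 (by linear_combination ht + 2 * e01 + h22 : 3 * x.1 0 0 = 0)).resolve_left h3
  rw [mem_comp_iff]
  refine ⟨x.1 0 1, x.1 0 2, Subtype.ext ?_⟩
  rw [comp_apply]
  ext i j
  fin_cases i <;> fin_cases j <;> simp
  · exact h00.symm
  · linear_combination e00
  · linear_combination e01 - h00
  · linear_combination e02
  · exact mul_left_cancel₀ ha0 (by linear_combination e10 + a ^ 2 * e02)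
  · exact mul_left_cancel₀ ha0 (by linear_combination e11 + e00)
  · linear_combination h22 + e01 - h00

lemma comp_eq_map_conj (h3 : (3 : F) ≠ 0) {u : F} (hu : IsPrimitiveRoot u 3) {a : F}
    (ha : a ^ 3 = 1) :
    ∃ Q : GL (Fin 3) F, comp a a = (diagSubalgebra F).map (conj Q).toLieHom := by
  have hu3 : u ^ 3 = 1 := hu.pow_eq_one
  have hu1 := one_add_add_sq hu
  obtain ⟨c, hc⟩ : ∃ c : F, 3 * c = 1 := ⟨3⁻¹, mul_inv_cancel₀ h3⟩
  let Q : GL (Fin 3) F :=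
    ⟨!![1, 1, 1; 1, u, u ^ 2; a ^ 2, a ^ 2 * u ^ 2, a ^ 2 * u],
      !![c, c, c * a; c, c * u ^ 2, c * a * u; c, c * u, c * a * u ^ 2],
      by
        ext i j
        fin_cases i <;> fin_cases j <;> simp [Matrix.mul_apply, Fin.sum_univ_three] <;> grind,
      by
        ext i j
        fin_cases i <;> fin_cases j <;> simp [Matrix.mul_apply, Fin.sum_univ_three] <;> grind⟩
  have hle : comp a a ≤ (diagSubalgebra F).map (conj Q).toLieHom := by
    rw [comp_le_iff]
    constructor
    · apply mem_map_conj_of_mul_eq (d := ![1, u, u ^ 2])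
      ext i j
      fin_cases i <;> fin_cases j <;>
        simp [Q, matX, Matrix.mul_apply, Fin.sum_univ_three] <;> grind
    · apply mem_map_conj_of_mul_eq (d := ![a ^ 2, a ^ 2 * u ^ 2, a ^ 2 * u])
      ext i j
      fin_cases i <;> fin_cases j <;>
        simp [Q, matY, Matrix.mul_apply, Fin.sum_univ_three] <;> grind
  refine ⟨Q, le_antisymm hle fun x hx => mem_comp_of_lie_matX_eq_zero h3 ha ?_⟩
  exact lie_eq_zero_of_isLieAbelian (isLieAbelian_map _ isLieAbelian_diagSubalgebra) hx
    (hle (matX_mem a a))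

lemma diag_nondegenerate (h2 : (2 : F) ≠ 0) (h3 : (3 : F) ≠ 0) {x : sl 3 F}
    (hx : x ∈ diagSubalgebra F)
    (h : ∀ y ∈ diagSubalgebra F, killingForm F (sl 3 F) x y = 0) : x = 0 := by
  have key (j : Fin 3) : x.1 j j = 0 := by
    have h0 := h _ (testEl j).2
    have hv : Matrix.trace (x.1 * (testEl j : diagSubalgebra F).1.1) =
        3 * x.1 j j - (x.1 0 0 + x.1 1 1 + x.1 2 2) := by
      rw [val_eq_diagonal hx, val_eq_diagonal (testEl j).2, Matrix.diagonal_mul_diagonal,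
        Matrix.trace_diagonal, Fin.sum_univ_three]
      simp only [testEl_apply, Matrix.diagonal_apply_eq]
      fin_cases j <;> simp <;> ring
    rw [killingForm_sl, hv, sl_trace] at h0
    have h18 : (2 * 3 * 3 : F) * x.1 j j = 0 := by linear_combination h0
    exact (mul_eq_zero.1 h18).resolve_left (mul_ne_zero (mul_ne_zero h2 h3) h3)
  apply Subtype.ext
  ext i j
  by_cases hij : i = j
  · subst hij
    exact key i
  · exact hx hij

lemma map_conj_nondegenerate (h2 : (2 : F) ≠ 0) (h3 : (3 : F) ≠ 0) {H : LieSubalgebra F (sl 3 F)}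
    {Q : GL (Fin 3) F} (hH : H = (diagSubalgebra F).map (conj Q).toLieHom) {x : sl 3 F}
    (hx : x ∈ H) (h : ∀ y ∈ H, killingForm F (sl 3 F) x y = 0) : x = 0 := by
  subst hH
  obtain ⟨d, hd, rfl⟩ := hx
  have : d = 0 := by
    refine diag_nondegenerate h2 h3 hd fun y hy => ?_
    rw [← LieAlgebra.killingForm_of_equiv_apply (conj Q)]
    exact h _ ⟨y, hy, rfl⟩
  rw [this]
  exact map_zero _

/-- Pairwise orthogonal conjugates of the diagonal subalgebra are independent. -/
lemma iSupIndep_of_orthogonal {ι : Type*} (h2 : (2 : F) ≠ 0) (h3 : (3 : F) ≠ 0)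
    {H : ι → LieSubalgebra F (sl 3 F)}
    (hH : ∀ i, ∃ Q : GL (Fin 3) F, H i = (diagSubalgebra F).map (conj Q).toLieHom)
    (horth : ∀ i j, i ≠ j → ∀ x ∈ H i, ∀ y ∈ H j, killingForm F (sl 3 F) x y = 0) :
    iSupIndep (fun i => (H i).toSubmodule) := by
  intro i
  rw [Submodule.disjoint_def]
  intro x hx hx'
  obtain ⟨Q, hQ⟩ := hH i
  refine map_conj_nondegenerate h2 h3 hQ hx fun y hy => ?_
  have hle : (⨆ (j) (_ : j ≠ i), (H j).toSubmodule) ≤ LinearMap.ker (killingForm F (sl 3 F) y) :=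
    iSup₂_le fun j hj z hz => horth i j hj.symm y hy z hz
  rw [killingForm_comm]
  exact hle hx'

lemma J3_one_one (u : F) :
    J3 u 1 1 = ![diagSubalgebra F, comp 1 1, comp u u, comp (u ^ 2) (u ^ 2)] := by
  simp [J3]

lemma iSup_J3 (h3 : (3 : F) ≠ 0) {u : F} (hu : IsPrimitiveRoot u 3) :
    (⨆ i, (J3 u 1 1 i).toSubmodule) = ⊤ := by
  have hu3 : u ^ 3 = 1 := hu.pow_eq_one
  have hu1 := one_add_add_sq hu
  obtain ⟨c, hc⟩ : ∃ c : F, 3 * c = 1 := ⟨3⁻¹, mul_inv_cancel₀ h3⟩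
  rw [J3_one_one]
  set S := ⨆ i, ((![diagSubalgebra F, comp 1 1, comp u u, comp (u ^ 2) (u ^ 2)] :
    Fin 4 → LieSubalgebra F (sl 3 F)) i).toSubmodule with hS
  have h0 (x : sl 3 F) (hx : x ∈ diagSubalgebra F) : x ∈ S := Submodule.mem_iSup_of_mem 0 hx
  have h1 (x : sl 3 F) (hx : x ∈ comp (1 : F) 1) : x ∈ S := Submodule.mem_iSup_of_mem 1 hx
  have h2 (x : sl 3 F) (hx : x ∈ comp u u) : x ∈ S := Submodule.mem_iSup_of_mem 2 hx
  have h4 (x : sl 3 F) (hx : x ∈ comp (u ^ 2) (u ^ 2)) : x ∈ S := Submodule.mem_iSup_of_mem 3 hx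
  have key (s₁ t₁ s₂ t₂ s₃ t₃ : F) : (s₁ • matX 1 1 + t₁ • matY 1 1) +
      (s₂ • matX u u + t₂ • matY u u) +
      (s₃ • matX (u ^ 2) (u ^ 2) + t₃ • matY (u ^ 2) (u ^ 2)) ∈ S :=
    S.add_mem (S.add_mem (h1 _ (mem_comp_iff.2 ⟨_, _, rfl⟩)) (h2 _ (mem_comp_iff.2 ⟨_, _, rfl⟩)))
      (h4 _ (mem_comp_iff.2 ⟨_, _, rfl⟩))
  have off {x : sl 3 F} {p q r p' q' r' : F}
      (hx : x.1 = !![0, p, p'; q', 0, q; r, r', 0]) : x ∈ S := by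
    have e := key (c * (p + q + r)) (c * (p' + q' + r')) (c * (p + u ^ 2 * q + u * r))
      (c * (p' + u * q' + u ^ 2 * r')) (c * (p + u * q + u ^ 2 * r))
      (c * (p' + u ^ 2 * q' + u * r'))
    convert e using 1
    apply Subtype.ext
    rw [AddMemClass.coe_add, AddMemClass.coe_add, comp_apply, comp_apply, comp_apply, hx]
    clear e key hx
    ext i j
    fin_cases i <;> fin_cases j <;> simp <;> grind
  apply eq_top_of_single_mem
  · intro i j hij r
    apply off (p := Matrix.single i j r 0 1) (q := Matrix.single i j r 1 2)
      (r := Matrix.single i j r 2 0) (p' := Matrix.single i j r 0 2)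
      (q' := Matrix.single i j r 1 0) (r' := Matrix.single i j r 2 1)
    rw [LieAlgebra.SpecialLinear.val_single]
    ext k l
    fin_cases k <;> fin_cases l <;> simp [Matrix.single_apply] <;> grind
  · intro h
    exact h0 _ h.2

lemma J3_eq_map_conj (h3 : (3 : F) ≠ 0) {u : F} (hu : IsPrimitiveRoot u 3) (i : Fin 4) :
    ∃ Q : GL (Fin 3) F, J3 u 1 1 i = (diagSubalgebra F).map (conj Q).toLieHom := by
  have hu3 : u ^ 3 = 1 := hu.pow_eq_one
  rw [J3_one_one]
  fin_cases i
  · exact ⟨1, (map_conj_one _).symm⟩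
  · exact comp_eq_map_conj h3 hu (one_pow 3)
  · exact comp_eq_map_conj h3 hu hu3
  · exact comp_eq_map_conj h3 hu (a := u ^ 2) (by rw [← pow_mul, mul_comm, pow_mul, hu3, one_pow])

lemma J3_orthogonal {u : F} (hu : IsPrimitiveRoot u 3) (i j : Fin 4) (hij : i ≠ j) :
    ∀ x ∈ J3 u 1 1 i, ∀ y ∈ J3 u 1 1 j, killingForm F (sl 3 F) x y = 0 := by
  have hu1 := one_add_add_sq hu
  wlog hlt : i < j generalizing i j
  · intro x hx y hy
    rw [killingForm_comm]
    exact this j i hij.symm (lt_of_le_of_ne (not_lt.1 hlt) hij.symm) y hy x hx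
  rw [J3_one_one]
  intro x hx y hy
  fin_cases i <;> fin_cases j <;> try exact absurd hlt (by decide)
  · exact killingForm_diag_comp hx hy
  · exact killingForm_diag_comp hx hy
  · exact killingForm_diag_comp hx hy
  · exact killingForm_comp_comp (by linear_combination hu1) hx hy
  · exact killingForm_comp_comp (a := 1) (b := u ^ 2)
      (by linear_combination (u ^ 2 - u + 1) * hu1) hx hy
  · exact killingForm_comp_comp (a := u) (b := u ^ 2) (by linear_combination u ^ 2 * hu1) hx hy

lemma isCOD_J3 (hchar : 3 < ringChar F) {u : F} (hu : IsPrimitiveRoot u 3) :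
    IsCOD (n := 3) (J3 u 1 1) := by
  have h2 : (2 : F) ≠ 0 := by
    exact_mod_cast natCast_ne_zero_of_lt_ringChar (F := F) two_ne_zero (by omega)
  have h3 : (3 : F) ≠ 0 := by
    exact_mod_cast natCast_ne_zero_of_lt_ringChar (F := F) three_ne_zero hchar
  refine ⟨fun i => ?_, J3_orthogonal hu,
    iSupIndep_of_orthogonal h2 h3 (J3_eq_map_conj h3 hu) (J3_orthogonal hu), iSup_J3 h3 hu⟩
  obtain ⟨Q, hQ⟩ := J3_eq_map_conj h3 hu i
  rw [hQ]
  exact (isClassicalCartan_diagSubalgebra hchar).map _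

end Components
section NormalForm

variable {F : Type*} [Field F]

/-- A normalized matrix whose conjugate of the torus is orthogonal to the torus diagonalizes
`comp 1 1`. -/
lemma map_conj_inv_eq_comp_one_one (h3 : (3 : F) ≠ 0)
    (hn : (comp (1 : F) 1).normalizer = comp 1 1) {R : GL (Fin 3) F}
    (h1 : ∀ j, R.val 0 j = 1) (hR : ∀ i j, 3 * (R.val i j * R⁻¹.val j i) = 1) :
    (diagSubalgebra F).map (conj R⁻¹).toLieHom = comp 1 1 := by
  have hone : R.val * R⁻¹.val = 1 := by rw [← Units.val_mul, mul_inv_cancel, Units.val_one]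
  have hR0 (i j : Fin 3) : R.val i j ≠ 0 := fun h => by simpa [h] using hR i j
  have hinv (i j : Fin 3) : R⁻¹.val j i = 3⁻¹ * (R.val i j)⁻¹ := by
    have := hR i j
    have := hR0 i j
    field_simp
    linear_combination hR i j
  have heig (i : Fin 3) : ∃ d : F, R.val i 2 = d * R.val i 0 ∧ R.val i 0 = d * R.val i 1 ∧
      R.val i 1 = d * R.val i 2 := by
    by_cases hi : i = 0
    · subst hi
      exact ⟨1, by simp [h1]⟩
    · have e1 := congrFun (congrFun hone i) 0
      have e2 := congrFun (congrFun hone 0) i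
      rw [Matrix.mul_apply, Fin.sum_univ_three, Matrix.one_apply_ne hi] at e1
      rw [Matrix.mul_apply, Fin.sum_univ_three, Matrix.one_apply_ne (Ne.symm hi)] at e2
      simp only [hinv, h1] at e1 e2
      have n0 := hR0 i 0
      have n1 := hR0 i 1
      have n2 := hR0 i 2
      have f1 : R.val i 0 + R.val i 1 + R.val i 2 = 0 := by
        field_simp at e1
        linear_combination e1
      have f2 : R.val i 1 * R.val i 2 + R.val i 0 * R.val i 2 + R.val i 0 * R.val i 1 = 0 := by
        field_simp at e2
        linear_combination e2
      refine ⟨R.val i 0 / R.val i 1, ?_, ?_, ?_⟩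
      · field_simp
        linear_combination f2 - R.val i 0 * f1
      · field_simp
      · field_simp
        linear_combination R.val i 1 * f1 - f2
  choose d hd0 hd1 hd2 using heig
  have hX : R.val * (matX (1 : F) 1).1 = Matrix.diagonal d * R.val := by
    ext i j
    rw [Matrix.diagonal_mul]
    fin_cases j
    · simpa [matX, Matrix.mul_apply, Fin.sum_univ_three] using hd0 i
    · simpa [matX, Matrix.mul_apply, Fin.sum_univ_three] using hd1 i
    · simpa [matX, Matrix.mul_apply, Fin.sum_univ_three] using hd2 i
  have hXY : (matY (1 : F) 1).1 = (matX (1 : F) 1).1 * (matX (1 : F) 1).1 := by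
    ext i j
    fin_cases i <;> fin_cases j <;> simp [matX, matY, Matrix.mul_apply, Fin.sum_univ_three]
  have hconj {x : sl 3 F} {d : Fin 3 → F} (h : R.val * x.1 = Matrix.diagonal d * R.val) :
      x ∈ (diagSubalgebra F).map (conj R⁻¹).toLieHom := by
    rw [mem_map_equiv, conj_symm, inv_inv]
    change (R.val * x.1 * R⁻¹.val).IsDiag
    rw [h, mul_assoc, hone, mul_one]
    exact Matrix.isDiag_diagonal d
  refine (eq_of_le_of_isLieAbelian hn (comp_le_iff.2 ⟨hconj hX, ?_⟩)
    (isLieAbelian_map _ isLieAbelian_diagSubalgebra)).symm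
  apply hconj (d := fun i => d i * d i)
  rw [hXY, ← mul_assoc, hX, mul_assoc, hX, ← mul_assoc, Matrix.diagonal_mul_diagonal]

/-- The invertible diagonal matrix with the given entries. -/
def diagGL (t : Fin 3 → Fˣ) : GL (Fin 3) F where
  val := Matrix.diagonal fun i => (t i : F)
  inv := Matrix.diagonal fun i => ((t i)⁻¹ : Fˣ).val
  val_inv := by simp
  inv_val := by simp

lemma diagGL_val (t : Fin 3 → Fˣ) : (diagGL t).val = Matrix.diagonal fun i => (t i : F) := rfl

lemma diagGL_inv (t : Fin 3 → Fˣ) : (diagGL t)⁻¹ = diagGL t⁻¹ := by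
  apply Units.ext
  rfl

lemma map_conj_diagGL (t : Fin 3 → Fˣ) :
    (diagSubalgebra F).map (conj (diagGL t)).toLieHom = diagSubalgebra F := by
  have hmem (t : Fin 3 → Fˣ) {x : sl 3 F} (hx : x ∈ diagSubalgebra F) :
      conj (diagGL t) x ∈ diagSubalgebra F := by
    intro i j hij
    change ((diagGL t).val * x.1 * (diagGL t)⁻¹.val) i j = 0
    rw [diagGL_inv, diagGL_val, diagGL_val, Matrix.mul_diagonal, Matrix.diagonal_mul,
      show x.1 i j = 0 from hx hij]
    simp
  ext x
  rw [mem_map_equiv, conj_symm, diagGL_inv]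
  refine ⟨fun h => ?_, hmem _⟩
  have := hmem t h
  rwa [← diagGL_inv, ← conj_symm, LieEquiv.apply_symm_apply] at this

/-- The matrix entries of a conjugate of the torus orthogonal to the torus. -/
lemma entries_of_orthogonal (h2 : (2 : F) ≠ 0) (h3 : (3 : F) ≠ 0) {Q : GL (Fin 3) F}
    (h : ∀ x ∈ diagSubalgebra F, ∀ y ∈ (diagSubalgebra F).map (conj Q).toLieHom,
      killingForm F (sl 3 F) x y = 0) (i j : Fin 3) :
    3 * (Q⁻¹.val i j * Q.val j i) = 1 := by
  have h0 := h _ (testEl j).2 _ ⟨(testEl i).1, (testEl i).2, rfl⟩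
  change killingForm F (sl 3 F) (testEl j).1 (conj Q (testEl i).1) = 0 at h0
  have e (k : Fin 3) : ((testEl k : diagSubalgebra F).1.1 : Matrix (Fin 3) (Fin 3) F) =
      (3 : F) • Matrix.single k k 1 - 1 := by
    rw [val_eq_diagonal (testEl k).2]
    ext a b
    by_cases hab : a = b
    · subst hab
      rw [Matrix.diagonal_apply_eq, testEl_apply]
      simp [Matrix.single_apply, eq_comm]
    · rw [Matrix.diagonal_apply_ne _ hab]
      simp only [Matrix.sub_apply, Matrix.smul_apply, Matrix.single_apply, Matrix.one_apply_ne hab]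
      rw [if_neg (by rintro ⟨rfl, rfl⟩; exact hab rfl)]
      simp
  have hone : Q.val * Q⁻¹.val = 1 := by rw [← Units.val_mul, mul_inv_cancel, Units.val_one]
  have hone' : Q⁻¹.val * Q.val = 1 := by rw [← Units.val_mul, inv_mul_cancel, Units.val_one]
  have hx : (conj Q (testEl i).1).1 =
      (3 : F) • (Q.val * Matrix.single i i 1 * Q⁻¹.val) - (1 : Matrix (Fin 3) (Fin 3) F) := by
    rw [conj_apply, e, mul_sub, sub_mul, mul_one, hone, mul_smul_comm, smul_mul_assoc]
  have ht : Matrix.trace (Q.val * Matrix.single i i 1 * Q⁻¹.val) = 1 := by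
    rw [Matrix.trace_mul_comm, ← mul_assoc, hone', one_mul, Matrix.trace_single_eq_same]
  have hp : Matrix.trace (Matrix.single j j 1 * (Q.val * Matrix.single i i 1 * Q⁻¹.val)) =
      Q⁻¹.val i j * Q.val j i := by
    rw [Matrix.trace_single_mul, mul_single_mul_apply, one_smul, mul_comm]
  rw [killingForm_sl, hx, e, sub_mul, mul_sub, one_mul, mul_one] at h0
  simp only [Matrix.trace_sub, smul_mul_assoc, mul_smul_comm, Matrix.trace_smul, hp, ht,
    Matrix.trace_single_eq_same, Matrix.trace_one, smul_eq_mul, Fintype.card_fin,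
    Nat.cast_ofNat] at h0
  have h18 : (2 * 3 * 3 : F) * (3 * (Q⁻¹.val i j * Q.val j i) - 1) = 0 := by
    linear_combination h0
  exact sub_eq_zero.1 ((mul_eq_zero.1 h18).resolve_left (mul_ne_zero (mul_ne_zero h2 h3) h3))

/-- A conjugate of the torus orthogonal to the torus is carried to `comp 1 1` by a diagonal
matrix. -/
lemma exists_diagGL_map_eq (h2 : (2 : F) ≠ 0) (h3 : (3 : F) ≠ 0)
    (hn : (comp (1 : F) 1).normalizer = comp 1 1) {Q : GL (Fin 3) F}
    (h : ∀ x ∈ diagSubalgebra F, ∀ y ∈ (diagSubalgebra F).map (conj Q).toLieHom,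
      killingForm F (sl 3 F) x y = 0) :
    ∃ t : Fin 3 → Fˣ,
      (diagSubalgebra F).map (conj (diagGL t * Q)).toLieHom = comp 1 1 := by
  have hent := entries_of_orthogonal h2 h3 h
  have h0 (i j : Fin 3) : Q⁻¹.val i j ≠ 0 := fun h0 => by simpa [h0] using hent i j
  let t : Fin 3 → Fˣ := fun j => Units.mk0 (Q⁻¹.val 0 j) (h0 0 j)
  refine ⟨t, ?_⟩
  have hinv : diagGL t * Q = (Q⁻¹ * diagGL t⁻¹)⁻¹ := by
    rw [mul_inv_rev, inv_inv, ← diagGL_inv, inv_inv]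
  rw [hinv]
  apply map_conj_inv_eq_comp_one_one h3 hn
  · intro j
    rw [Units.val_mul, diagGL_val, Matrix.mul_diagonal]
    rw [Pi.inv_apply, Units.val_inv_eq_inv_val]
    exact mul_inv_cancel₀ (h0 0 j)
  · intro i j
    rw [← hinv, Units.val_mul, Units.val_mul, diagGL_val, diagGL_val, Matrix.mul_diagonal,
      Matrix.diagonal_mul, ← hent i j, Pi.inv_apply]
    have := Units.inv_mul (t j)
    linear_combination (3 * (Q⁻¹.val i j * Q.val j i)) * this

/-- Diagonal conjugates of `comp 1 1` are again of the form `comp a b`. -/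
lemma exists_map_comp_eq (hn : (comp (1 : F) 1).normalizer = comp 1 1) (t : Fin 3 → Fˣ) :
    ∃ a b : F, (comp 1 1).map (conj (diagGL t)).toLieHom = comp a b := by
  have e0 := (t 0).ne_zero
  have e1 := (t 1).ne_zero
  have e2 := (t 2).ne_zero
  refine ⟨(t 1 * t 1 : F) / (t 0 * t 2), (t 2 * t 2 : F) / (t 0 * t 1),
    eq_of_le_of_isLieAbelian (self_normalizing_map _ hn) ?_ (isLieAbelian_comp _ _)⟩
  rw [LieSubalgebra.map_le_iff_le_comap, comp_le_iff]
  change conj _ _ ∈ comp _ _ ∧ conj _ _ ∈ comp _ _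
  rw [mem_comp_iff, mem_comp_iff]
  constructor
  · refine ⟨(t 0 : F) / t 1, 0, Subtype.ext ?_⟩
    rw [comp_apply, conj_apply, diagGL_inv, diagGL_val, diagGL_val]
    ext i j
    rw [Matrix.mul_diagonal, Matrix.diagonal_mul]
    fin_cases i <;> fin_cases j <;> simp [matX] <;> field_simp
  · refine ⟨0, (t 0 : F) / t 2, Subtype.ext ?_⟩
    rw [comp_apply, conj_apply, diagGL_inv, diagGL_val, diagGL_val]
    ext i j
    rw [Matrix.mul_diagonal, Matrix.diagonal_mul]
    fin_cases i <;> fin_cases j <;> simp [matY] <;> field_simp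

/-- A conjugate of the torus orthogonal to both the torus and `comp 1 1` is one of the two
remaining components of `J3 u 1 1`. -/
lemma eq_comp_of_orthogonal (h2 : (2 : F) ≠ 0) (h3 : (3 : F) ≠ 0)
    (hn : (comp (1 : F) 1).normalizer = comp 1 1) {u : F} (hu : IsPrimitiveRoot u 3)
    {H : LieSubalgebra F (sl 3 F)} {Q : GL (Fin 3) F}
    (hH : H = (diagSubalgebra F).map (conj Q).toLieHom)
    (h0 : ∀ x ∈ diagSubalgebra F, ∀ y ∈ H, killingForm F (sl 3 F) x y = 0)
    (h1 : ∀ x ∈ comp (1 : F) 1, ∀ y ∈ H, killingForm F (sl 3 F) x y = 0) :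
    H = comp u u ∨ H = comp (u ^ 2) (u ^ 2) := by
  have hu1 := one_add_add_sq hu
  have h6 : (6 : F) ≠ 0 := by
    rw [show (6 : F) = 2 * 3 by norm_num]
    exact mul_ne_zero h2 h3
  obtain ⟨t, ht⟩ := exists_diagGL_map_eq h2 h3 hn (hH ▸ h0)
  obtain ⟨a, b, hab⟩ := exists_map_comp_eq hn t⁻¹
  rw [← ht, map_conj_conj, ← diagGL_inv, inv_mul_cancel_left, ← hH] at hab
  rw [hab] at h1 ⊢
  have hX := h1 _ (matX_mem 1 1) _ (matY_mem a b)
  have hY := h1 _ (matY_mem 1 1) _ (matX_mem a b)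
  rw [killingForm_sl, trace_matX_matY] at hX
  rw [killingForm_sl, trace_matY_matX] at hY
  replace hX := (mul_eq_zero.1 hX).resolve_left h6
  replace hY := (mul_eq_zero.1 hY).resolve_left h6
  obtain rfl : a = b := by linear_combination hY - hX
  have hroot : (a - u) * (a - u ^ 2) = 0 := by
    linear_combination hX + (u - 1 - a) * hu1
  rcases mul_eq_zero.1 hroot with h | h
  · left
    rw [sub_eq_zero.1 h]
  · right
    rw [sub_eq_zero.1 h]

/-- Orthogonal subalgebras are not both equal to `comp a a`. -/
lemma comp_ne_of_orthogonal (h2 : (2 : F) ≠ 0) (h3 : (3 : F) ≠ 0) {a : F} (ha : a ≠ 0)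
    {H K : LieSubalgebra F (sl 3 F)}
    (h : ∀ x ∈ H, ∀ y ∈ K, killingForm F (sl 3 F) x y = 0) :
    ¬ (H = comp a a ∧ K = comp a a) := by
  rintro ⟨rfl, rfl⟩
  have := h _ (matX_mem a a) _ (matY_mem a a)
  rw [killingForm_sl, trace_matX_matY] at this
  have h' : (2 * 3 * 3 : F) * a ^ 2 = 0 := by linear_combination this
  simp [h2, h3, ha] at h'

/-- Every classical orthogonal decomposition of `sl 3 F` is conjugate to `J3 u 1 1`. -/
lemma conjugate_J3 (hchar : 3 < ringChar F) {u : F} (hu : IsPrimitiveRoot u 3)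
    {H : Fin 4 → LieSubalgebra F (sl 3 F)} (hH : IsCOD (n := 3) H) :
    Conjugate H (J3 u 1 1) := by
  have h2 : (2 : F) ≠ 0 := by
    exact_mod_cast natCast_ne_zero_of_lt_ringChar (F := F) two_ne_zero (by omega)
  have h3 : (3 : F) ≠ 0 := by
    exact_mod_cast natCast_ne_zero_of_lt_ringChar (F := F) three_ne_zero hchar
  have hu0 : u ≠ 0 := hu.ne_zero (by norm_num)
  have hn : (comp (1 : F) 1).normalizer = comp 1 1 := by
    obtain ⟨Q, hQ⟩ := comp_eq_map_conj h3 hu (one_pow 3)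
    rw [hQ]
    exact self_normalizing_map _ (diagSubalgebra_normalizer h3)
  choose P hP using fun i => (hH.classical i).exists_eq_map_conj h3
  have horth (Q : GL (Fin 3) F) (i j : Fin 4) (hij : i ≠ j) :
      ∀ x ∈ (H i).map (conj Q).toLieHom, ∀ y ∈ (H j).map (conj Q).toLieHom,
        killingForm F (sl 3 F) x y = 0 := by
    rintro _ ⟨x, hx, rfl⟩ _ ⟨y, hy, rfl⟩
    exact (LieAlgebra.killingForm_of_equiv_apply (conj Q) x y).trans
      (hH.orthogonal i j hij x hx y hy)
  have hmap (Q : GL (Fin 3) F) (i : Fin 4) : (H i).map (conj Q).toLieHom =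
      (diagSubalgebra F).map (conj (Q * P i)).toLieHom := by
    rw [← map_conj_conj, ← hP]
  have h00 : (H 0).map (conj (P 0)⁻¹).toLieHom = diagSubalgebra F := by
    rw [hmap, inv_mul_cancel, map_conj_one]
  obtain ⟨t, ht⟩ := exists_diagGL_map_eq h2 h3 hn (Q := (P 0)⁻¹ * P 1) (by
    rw [← hmap, ← h00]
    exact horth _ 0 1 (by decide))
  set Q := diagGL t * (P 0)⁻¹ with hQ
  have e0 : (H 0).map (conj Q).toLieHom = diagSubalgebra F := by
    rw [hQ, ← map_conj_conj, h00, map_conj_diagGL]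
  have e1 : (H 1).map (conj Q).toLieHom = comp 1 1 := by
    rw [hmap, hQ, mul_assoc, ht]
  have hi (i : Fin 4) (hi0 : i ≠ 0) (hi1 : i ≠ 1) := eq_comp_of_orthogonal h2 h3 hn hu (hmap Q i)
    (e0 ▸ horth Q 0 i hi0.symm) (e1 ▸ horth Q 1 i hi1.symm)
  have h23 := horth Q 2 3 (by decide)
  rw [J3_one_one]
  rcases hi 2 (by decide) (by decide) with e2 | e2 <;>
    rcases hi 3 (by decide) (by decide) with e3 | e3
  · exact absurd ⟨e2, e3⟩ (comp_ne_of_orthogonal h2 h3 hu0 h23)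
  · refine ⟨conj Q, 1, fun i => ?_⟩
    fin_cases i
    exacts [e0, e1, e2, e3]
  · refine ⟨conj Q, Equiv.swap 2 3, fun i => ?_⟩
    fin_cases i
    exacts [e0, e1, e2, e3]
  · exact absurd ⟨e2, e3⟩ (comp_ne_of_orthogonal h2 h3 (pow_ne_zero 2 hu0) h23)

lemma not_isDiagonalizable_comp {z : F} (hz : ¬ ∃ c : F, c ^ 3 = z) :
    ¬ IsDiagonalizable (comp 1 z) := by
  rintro ⟨P, hP⟩
  apply hz
  have hdiag := hP _ (matX_mem 1 z)
  have hX : (matX 1 z).1 * (matX 1 z).1 * (matX 1 z).1 = z • (1 : Matrix (Fin 3) (Fin 3) F) := by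
    ext i j
    fin_cases i <;> fin_cases j <;> simp [matX, Matrix.mul_apply, Fin.sum_univ_three]
  have h : P⁻¹.val * P.val = 1 := by rw [← Units.val_mul, inv_mul_cancel, Units.val_one]
  have h' : P.val * P⁻¹.val = 1 := by rw [← Units.val_mul, mul_inv_cancel, Units.val_one]
  set D := P.val * (matX 1 z).1 * P⁻¹.val with hD
  have hcube : D * D * D = z • (1 : Matrix (Fin 3) (Fin 3) F) := by
    calc D * D * D = P.val * (matX 1 z).1 * (P⁻¹.val * P.val) * (matX 1 z).1 *
          (P⁻¹.val * P.val) * (matX 1 z).1 * P⁻¹.val := by rw [hD]; noncomm_ring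
      _ = P.val * ((matX 1 z).1 * (matX 1 z).1 * (matX 1 z).1) * P⁻¹.val := by
        rw [h]; noncomm_ring
      _ = _ := by rw [hX, mul_smul_comm, smul_mul_assoc, mul_one, h']
  refine ⟨D 0 0, ?_⟩
  have := congrFun (congrFun hcube 0) 0
  rw [← hdiag.diagonal_diag, Matrix.diagonal_mul_diagonal, Matrix.diagonal_mul_diagonal] at this
  simp only [Matrix.diagonal_apply_eq, Matrix.diag_apply, Matrix.smul_apply, Matrix.one_apply_eq,
    smul_eq_mul, mul_one] at this
  rw [← this]
  ring

lemma exists_isPrimitiveRoot_three [Fintype F] (hq : 3 ∣ Fintype.card F - 1) :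
    ∃ u : F, IsPrimitiveRoot u 3 := by
  classical
  obtain ⟨g, hg⟩ := IsCyclic.exists_generator (α := Fˣ)
  obtain ⟨k, hk⟩ := hq
  have hord : orderOf g = k * 3 := by
    rw [orderOf_eq_card_of_forall_mem_zpowers hg, Nat.card_eq_fintype_card, Fintype.card_units, hk,
      mul_comm]
  have hpos : 0 < Fintype.card F - 1 := Nat.sub_pos_of_lt Fintype.one_lt_card
  refine ⟨(g ^ k : Fˣ), IsPrimitiveRoot.coe_units_iff.2 ?_⟩
  exact (IsPrimitiveRoot.orderOf g).pow (by omega) hord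

end NormalForm
end ClassicalOD

theorem theorem3p10 {F : Type*} [Field F] [Fintype F]
    (hchar : 3 < ringChar F) (hq : 3 ∣ Fintype.card F - 1) :
    (∃ u : F, IsPrimitiveRoot u 3) ∧
    ∀ u : F, IsPrimitiveRoot u 3 →
      ClassicalOD.IsCOD (n := 3) (ClassicalOD.J3 u 1 1) ∧
      (∀ H : Fin 4 → LieSubalgebra F (ClassicalOD.sl 3 F),
        ClassicalOD.IsCOD (n := 3) H → ClassicalOD.Conjugate H (ClassicalOD.J3 u 1 1)) ∧
      (∀ z : F, (¬ ∃ c : F, c ^ 3 = z) →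
        ¬ ClassicalOD.IsDiagonalizable (ClassicalOD.J3 u 1 z 1) ∧
        ¬ ClassicalOD.IsClassicalCartan (ClassicalOD.J3 u 1 z 1)) := by
  have h3 : (3 : F) ≠ 0 := by
    exact_mod_cast natCast_ne_zero_of_lt_ringChar (F := F) three_ne_zero hchar
  refine ⟨exists_isPrimitiveRoot_three hq, fun u hu =>
    ⟨isCOD_J3 hchar hu, fun H hH => conjugate_J3 hchar hu hH, fun z hz => ?_⟩⟩
  have hnd : ¬ IsDiagonalizable (J3 u 1 z 1) := not_isDiagonalizable_comp hz
  exact ⟨hnd, fun hc => hnd (hc.isDiagonalizable h3)⟩
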